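/- Let $\Sigma$ be a finite alphabet with at least two elements, and let $\Pr$ be the uniform probability measure on $\Sigma^\omega$, i.e. the probability measure on the $\sigma$-algebra generated by the cylinder sets with $\Pr\{w : a_1\cdots a_n \text{ is a prefix of } w\} = |\Sigma|^{-n}$ for all $a_1,\dots,a_n\in\Sigma$. Let $\mathcal U=(Q,\Sigma,\delta,Q_0,F)$ be a Büchi automaton with finite state set $Q$, transition function $\delta: Q\times\Sigma\to 2^Q$, nonempty set $Q_0\subseteq Q$ of initial states and nonempty set $F\subseteq Q$ of final states. An accepting run of $\mathcal U$ for $w=a_1a_2\cdots\in\Sigma^\omega$ is a sequence $q_0q_1\cdots\in Q^\omega$ with $q_0\in Q_0$, $q_{i+1}\in\delta(q_i,a_{i+1})$ for all $i\ge 0$, and $q_i\in F$ for infinitely many $i$; $\mathcal L_\omega(\mathcal U)$ is the set of words in $\Sigma^\omega$ that have at least one accepting run. Assume that $\mathcal U$ is unambiguous (each $w\in\Sigma^\omega$ has at most one accepting run) and strongly connected (every state is reachable from every state). Define $M\in[0,1]^{Q\times Q}$ by $$M_{p,q}=\frac{|\{a\in\Sigma : q\in\delta(p,a)\}|}{|\Sigma|},$$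 and let $\rho(M)$ be its spectral radius, i.e. the maximum of the absolute values of its complex eigenvalues. Then $\rho(M)\le 1$. Moreover, $\rho(M)=1$ if and only if $\Pr(\mathcal L_\omega(\mathcal U))>0$. -/

import Mathlib

open MeasureTheory

/-- A nondeterministic Büchi automaton `(Q, A, δ, Q₀, F)` with state set `Q` and alphabet `A`:
`step` is `δ : Q × A → 2^Q`, `start` is `Q₀` and `accept` is `F`. -/
structure NBA (A Q : Type*) where
  step : Q → A → Set Q
  start : Set Q
  accept : Set Q

namespace NBA

variable {A Q : Type*}

/-- `r` is a run of `U` for the infinite word `w` (letters and states are indexed from `0`). -/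
def IsRun (U : NBA A Q) (w : ℕ → A) (r : ℕ → Q) : Prop :=
  r 0 ∈ U.start ∧ ∀ i, r (i + 1) ∈ U.step (r i) (w i)

/-- `r` is a run of `U` for `w` that visits accepting states infinitely often. -/
def IsAcceptingRun (U : NBA A Q) (w : ℕ → A) (r : ℕ → Q) : Prop :=
  U.IsRun w r ∧ {i | r i ∈ U.accept}.Infinite

/-- The `ω`-language of `U`: the infinite words with at least one accepting run. -/
def omegaLanguage (U : NBA A Q) : Set (ℕ → A) :=
  {w | ∃ r, U.IsAcceptingRun w r}

/-- Each infinite word has at most one accepting run. -/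
def IsUnambiguous (U : NBA A Q) : Prop :=
  ∀ w r r', U.IsAcceptingRun w r → U.IsAcceptingRun w r' → r = r'

/-- Every state is reachable from every state along transitions of the automaton. -/
def IsStronglyConnected (U : NBA A Q) : Prop :=
  ∀ p q, Relation.ReflTransGen (fun s t => ∃ a, t ∈ U.step s a) p q

/-- The matrix `M` with `M p q = |{a : q ∈ δ(p, a)}| / |A|`. -/
noncomputable def transitionMatrix [Fintype A] (U : NBA A Q) : Matrix Q Q ℝ :=
  Matrix.of fun p q => ({a | q ∈ U.step p a}.ncard : ℝ) / (Fintype.card A : ℝ)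

end NBA

/-- The uniform probability measure on infinite words: letters are independent and uniformly
distributed, so the cylinder set of a word of length `n` has measure `1 / |A| ^ n`. -/
noncomputable def uniformWordMeasure (A : Type*) [Fintype A] [Nonempty A] [MeasurableSpace A] :
    Measure (ℕ → A) :=
  Measure.infinitePi fun _ : ℕ => (PMF.uniformOfFintype A).toMeasure

/-- The spectral radius of a real square matrix: the largest modulus of its complex eigenvalues. -/
noncomputable def realMatrixSpectralRadius {Q : Type*} [Fintype Q] [DecidableEq Q]
    (M : Matrix Q Q ℝ) : ENNReal :=
  spectralRadius ℂ (M.map Complex.ofReal)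

/-!
Unambiguity and strong connectedness make the automaton diamond-free: a word that labels two paths
from `p` to `q` could be continued from `q` to a word with two accepting runs from `p`, and then,
through a path from an initial state to `p`, to a word with two accepting runs. Hence `(M ^ n) p q`
is the probability that the prefix of length `n` of a random word labels a path from `p` to `q`; the
powers of `M` are bounded, so `ρ(M) ≤ 1`.

A word is *live* from `p` if all its prefixes label paths from `p`; by König's lemma it then has an
infinite run from `p`. The vector `y` of the live probabilities satisfies `y ≤ M y`, so `ρ(M) ≥ 1`
by the Collatz–Wielandt bound as soon as `y ≠ 0`, in particular if the language has positive
probability.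

Conversely, `ρ(M) = 1` yields a nonzero `x ≥ 0` with `x ≤ M x`, hence `x ≤ M ^ n x`, and this bounds
the probability of being live from below. It remains to see that almost every live word is accepted.
A live word that is not accepted is, after finitely many steps, live for the automaton that avoids
accepting states. The matrix `N` of that automaton satisfies `N ≤ M` and `N ≠ M`, and its vector `z`
of live probabilities satisfies `z ≤ N z`. As `M` is irreducible with bounded powers, Wielandt's
argument leaves only `z = 0`.
-/

section OrderedMatrix

open Matrix

theorem exists_pos_of_nonneg_of_ne_zero {ι R : Type*} [Zero R] [PartialOrder R] {x : ι → R}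
    (hx : 0 ≤ x) (hx0 : x ≠ 0) : ∃ i, 0 < x i := by
  obtain ⟨i, hi⟩ := Function.ne_iff.1 hx0
  exact ⟨i, (hx i).lt_of_ne' hi⟩

theorem exists_apply_pos_of_isIrreducible {ι R : Type*} [Ring R] [LinearOrder R]
    {M : Matrix ι ι R} (hM : M.IsIrreducible) (j : ι) : ∃ i, 0 < M i j := by
  let := toQuiver M
  obtain ⟨path, hpath⟩ := hM.connected j j
  cases path with
  | nil => exact absurd hpath (lt_irrefl 0)
  | cons _ edge => exact ⟨_, edge.down⟩

variable {n R : Type*} [Fintype n] [CommRing R] [LinearOrder R] [IsStrictOrderedRing R]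

theorem mulVec_mono_of_nonneg {M : Matrix n n R} (hM : ∀ i j, 0 ≤ M i j) :
    Monotone (M *ᵥ ·) :=
  fun _ _ hxy i => dotProduct_le_dotProduct_of_nonneg_left hxy (hM i)

theorem apply_mul_apply_le_mulVec {M : Matrix n n R} (hM : ∀ i j, 0 ≤ M i j) {x : n → R}
    (hx : 0 ≤ x) (i j : n) : M i j * x j ≤ (M *ᵥ x) i :=
  Finset.single_le_sum (f := fun k => M i k * x k) (fun k _ => mul_nonneg (hM i k) (hx k))
    (Finset.mem_univ j)

theorem mulVec_apply_le_mul_sum {M : Matrix n n R} {x : n → R} (hx : 0 ≤ x) {i : n} {c : R}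
    (hc : ∀ j, M i j ≤ c) : (M *ᵥ x) i ≤ c * ∑ j, x j := by
  rw [Finset.mul_sum]
  exact Finset.sum_le_sum fun j _ => mul_le_mul_of_nonneg_right (hc j) (hx j)

section Powers

variable [DecidableEq n] {M : Matrix n n R} {x : n → R}

theorem pow_apply_mul_pow_apply_le (hM : ∀ i j, 0 ≤ M i j) (k l : ℕ) (i j m : n) :
    (M ^ k) i j * (M ^ l) j m ≤ (M ^ (k + l)) i m := by
  rw [pow_add]
  exact apply_mul_apply_le_mulVec (pow_apply_nonneg hM k)
    (fun j => pow_apply_nonneg hM l j m) i j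

theorem pow_smul_le_pow_mulVec (hM : ∀ i j, 0 ≤ M i j) {c : R} (hc : 0 ≤ c)
    (hx : c • x ≤ M *ᵥ x) (k : ℕ) : c ^ k • x ≤ M ^ k *ᵥ x := by
  induction k with
  | zero => simp
  | succ k ih =>
    calc c ^ (k + 1) • x = c • c ^ k • x := by rw [smul_smul, pow_succ']
      _ ≤ c • M ^ k *ᵥ x := smul_le_smul_of_nonneg_left ih hc
      _ = M ^ k *ᵥ c • x := (mulVec_smul _ _ _).symm
      _ ≤ M ^ k *ᵥ M *ᵥ x := mulVec_mono_of_nonneg (pow_apply_nonneg hM k) hx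
      _ = M ^ (k + 1) *ᵥ x := by rw [mulVec_mulVec, pow_succ]

theorem monotone_pow_mulVec (hM : ∀ i j, 0 ≤ M i j) (hx : x ≤ M *ᵥ x) :
    Monotone fun k => M ^ k *ᵥ x :=
  monotone_nat_of_le_succ fun k => by
    simpa only [mulVec_mulVec, ← pow_succ]
      using mulVec_mono_of_nonneg (pow_apply_nonneg hM k) hx

theorem le_pow_mulVec (hM : ∀ i j, 0 ≤ M i j) (hx : x ≤ M *ᵥ x) (k : ℕ) : x ≤ M ^ k *ᵥ x := by
  simpa using monotone_pow_mulVec hM hx k.zero_le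

theorem pow_mulVec_le (hM : ∀ i j, 0 ≤ M i j) (hx : M *ᵥ x ≤ x) (k : ℕ) : M ^ k *ᵥ x ≤ x := by
  induction k with
  | zero => simp
  | succ k ih =>
    rw [pow_succ, ← mulVec_mulVec]
    exact (mulVec_mono_of_nonneg (pow_apply_nonneg hM k) hx).trans ih

end Powers

theorem pos_of_isIrreducible_of_mulVec_le {M : Matrix n n R} {x : n → R} (hM : M.IsIrreducible)
    (hx : 0 ≤ x) (hx0 : x ≠ 0) (hMx : M *ᵥ x ≤ x) (i : n) : 0 < x i := by
  classical
  obtain ⟨j, hj⟩ := exists_pos_of_nonneg_of_ne_zero hx hx0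
  obtain ⟨k, -, hk⟩ := (isIrreducible_iff_exists_pow_pos hM.nonneg).1 hM i j
  calc 0 < (M ^ k) i j * x j := mul_pos hk hj
    _ ≤ (M ^ k *ᵥ x) i := apply_mul_apply_le_mulVec (pow_apply_nonneg hM.nonneg k) hx i j
    _ ≤ x i := pow_mulVec_le hM.nonneg hMx k i

end OrderedMatrix

section PowerBounded

open Filter Topology Matrix

variable {n : Type*} [Fintype n] [DecidableEq n] {M : Matrix n n ℝ} {C : ℝ} {x : n → ℝ}

theorem tendsto_pow_mulVec_mulVec_sub_self (hM : ∀ i j, 0 ≤ M i j)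
    (hC : ∀ k i j, (M ^ k) i j ≤ C) (hx : 0 ≤ x) (hMx : x ≤ M *ᵥ x) :
    Tendsto (fun k => M ^ k *ᵥ (M *ᵥ x - x)) atTop (𝓝 0) := by
  refine tendsto_pi_nhds.2 fun i => ?_
  have hlim := tendsto_atTop_ciSup (fun k l hkl => monotone_pow_mulVec hM hMx hkl i)
    ⟨C * ∑ j, x j, Set.forall_mem_range.2 fun k => mulVec_apply_le_mul_sum hx (hC k i)⟩
  have hdiff := ((tendsto_add_atTop_iff_nat 1).2 hlim).sub hlim
  simpa only [mulVec_sub, mulVec_mulVec, ← pow_succ, sub_self, Pi.sub_apply, Pi.zero_apply]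
    using hdiff

theorem tendsto_pow_apply_zero_of_isIrreducible (hM : M.IsIrreducible) (hx : 0 ≤ x) (hx0 : x ≠ 0)
    (hlim : Tendsto (fun k => M ^ k *ᵥ x) atTop (𝓝 0)) (i j : n) :
    Tendsto (fun k => (M ^ k) i j) atTop (𝓝 0) := by
  obtain ⟨m, hm⟩ := exists_pos_of_nonneg_of_ne_zero hx hx0
  obtain ⟨l, -, hl⟩ := (isIrreducible_iff_exists_pow_pos hM.nonneg).1 hM j m
  have hshift := ((tendsto_pi_nhds.1 hlim i).comp (tendsto_add_atTop_nat l)).div_const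
    ((M ^ l) j m * x m)
  rw [Pi.zero_apply, zero_div] at hshift
  refine squeeze_zero (fun k => pow_apply_nonneg hM.nonneg k i j) (fun k => ?_) hshift
  rw [le_div_iff₀ (mul_pos hl hm), ← mul_assoc]
  calc (M ^ k) i j * (M ^ l) j m * x m ≤ (M ^ (k + l)) i m * x m :=
        mul_le_mul_of_nonneg_right (pow_apply_mul_pow_apply_le hM.nonneg k l i j m) hm.le
    _ ≤ (M ^ (k + l) *ᵥ x) i :=
        apply_mul_apply_le_mulVec (pow_apply_nonneg hM.nonneg _) hx i m

theorem mulVec_eq_of_isIrreducible_of_le_mulVec (hM : M.IsIrreducible)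
    (hC : ∀ k i j, (M ^ k) i j ≤ C) (hx : 0 ≤ x) (hMx : x ≤ M *ᵥ x) : M *ᵥ x = x := by
  by_contra hne
  have hpow := tendsto_pow_apply_zero_of_isIrreducible hM (sub_nonneg.2 hMx) (sub_ne_zero.2 hne)
    (tendsto_pow_mulVec_mulVec_sub_self hM.nonneg hC hx hMx)
  have hx0 : x ≤ 0 := fun i => by
    have hlim : Tendsto (fun k => (M ^ k *ᵥ x) i) atTop (𝓝 (∑ j, 0 * x j)) :=
      tendsto_finsetSum _ fun j _ => (hpow i j).mul_const (x j)
    simp only [zero_mul, Finset.sum_const_zero] at hlim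
    exact ge_of_tendsto' hlim fun k => le_pow_mulVec hM.nonneg hMx k i
  simp [hx0.antisymm hx] at hne

theorem pos_of_isIrreducible_of_le_mulVec (hM : M.IsIrreducible)
    (hC : ∀ k i j, (M ^ k) i j ≤ C) (hx : 0 ≤ x) (hx0 : x ≠ 0) (hMx : x ≤ M *ᵥ x) (i : n) :
    0 < x i :=
  pos_of_isIrreducible_of_mulVec_le hM hx hx0
    (mulVec_eq_of_isIrreducible_of_le_mulVec hM hC hx hMx).le i

theorem eq_of_le_of_isIrreducible_of_le_mulVec {N : Matrix n n ℝ} (hM : M.IsIrreducible)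
    (hC : ∀ k i j, (M ^ k) i j ≤ C) (hNM : ∀ i j, N i j ≤ M i j) (hx : 0 ≤ x) (hx0 : x ≠ 0)
    (hNx : x ≤ N *ᵥ x) : N = M := by
  have hNMx : N *ᵥ x ≤ M *ᵥ x := fun i => dotProduct_le_dotProduct_of_nonneg_right (hNM i) hx
  have hpos := pos_of_isIrreducible_of_le_mulVec hM hC hx hx0 (hNx.trans hNMx)
  have heq : N *ᵥ x = M *ᵥ x := hNMx.antisymm <|
    (mulVec_eq_of_isIrreducible_of_le_mulVec hM hC hx (hNx.trans hNMx)).trans_le hNx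
  ext i j
  have hsum := (Finset.sum_eq_sum_iff_of_le fun j _ =>
    mul_le_mul_of_nonneg_right (hNM i j) (hx j)).1 (congrFun heq i)
  exact mul_right_cancel₀ (hpos j).ne' (hsum j (Finset.mem_univ j))

end PowerBounded

section SpectralRadius

open Filter Topology Matrix

variable {n : Type*} [Fintype n] [DecidableEq n] {M : Matrix n n ℝ}

/-- The triangle inequality applied to the moduli of the entries of an eigenvector. -/
theorem exists_norm_smul_le_mulVec_of_mem_spectrum (hM : ∀ i j, 0 ≤ M i j) {z : ℂ}
    (hz : z ∈ spectrum ℂ (M.map Complex.ofReal)) :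
    ∃ x : n → ℝ, 0 ≤ x ∧ x ≠ 0 ∧ ‖z‖ • x ≤ M *ᵥ x := by
  rw [← Matrix.spectrum_toLin', ← Module.End.hasEigenvalue_iff_mem_spectrum] at hz
  obtain ⟨v, hv⟩ := hz.exists_hasEigenvector
  have hMv : M.map Complex.ofReal *ᵥ v = z • v := by
    simpa only [Matrix.toLin'_apply] using hv.apply_eq_smul
  refine ⟨fun i => ‖v i‖, fun i => norm_nonneg _, fun h => hv.2 ?_, fun i => ?_⟩
  · exact funext fun i => norm_eq_zero.1 (congrFun h i)
  · calc ‖z‖ * ‖v i‖ = ‖∑ j, (M i j : ℂ) * v j‖ := by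
          rw [← norm_mul]; exact congrArg norm (congrFun hMv i).symm
      _ ≤ ∑ j, ‖(M i j : ℂ) * v j‖ := norm_sum_le _ _
      _ = ∑ j, M i j * ‖v j‖ := by
          simp only [norm_mul, Complex.norm_real, Real.norm_of_nonneg (hM _ _)]

theorem realMatrixSpectralRadius_le_one_of_pow_le (hM : ∀ i j, 0 ≤ M i j) {C : ℝ}
    (hC : ∀ k i j, (M ^ k) i j ≤ C) : realMatrixSpectralRadius M ≤ 1 := by
  refine iSup₂_le fun z hz => ?_
  obtain ⟨x, hx, hx0, hzx⟩ := exists_norm_smul_le_mulVec_of_mem_spectrum hM hz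
  obtain ⟨i, hi⟩ := exists_pos_of_nonneg_of_ne_zero hx hx0
  have hbdd (k : ℕ) : ‖z‖ ^ k ≤ (C * ∑ j, x j) / x i := by
    rw [le_div_iff₀ hi]
    exact (pow_smul_le_pow_mulVec hM (norm_nonneg z) hzx k i).trans
      (mulVec_apply_le_mul_sum hx (hC k i))
  have hz1 : ‖z‖ ≤ 1 := by
    by_contra! h
    obtain ⟨k, hk⟩ := pow_unbounded_of_one_lt ((C * ∑ j, x j) / x i) h
    exact hk.not_ge (hbdd k)
  exact_mod_cast hz1

open scoped Matrix.Norms.Operator in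
theorem exists_realMatrixSpectralRadius_smul_le_mulVec [Nonempty n] (hM : ∀ i j, 0 ≤ M i j) :
    ∃ x : n → ℝ, 0 ≤ x ∧ x ≠ 0 ∧ (realMatrixSpectralRadius M).toReal • x ≤ M *ᵥ x := by
  obtain ⟨z, hz, hρ⟩ := spectrum.exists_nnnorm_eq_spectralRadius (M.map Complex.ofReal)
  simpa only [realMatrixSpectralRadius, ← hρ, ENNReal.coe_toReal, coe_nnnorm]
    using exists_norm_smul_le_mulVec_of_mem_spectrum hM hz

open scoped Matrix.Norms.Operator in
theorem linfty_opNorm_map_ofReal (M : Matrix n n ℝ) : ‖M.map Complex.ofReal‖ = ‖M‖ := by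
  simp only [linfty_opNorm_def, map_apply, Complex.nnnorm_real]

open scoped Matrix.Norms.Operator in
theorem pow_le_linfty_opNorm_pow_of_smul_le_mulVec (hM : ∀ i j, 0 ≤ M i j) {x : n → ℝ}
    (hx : 0 ≤ x) (hx0 : x ≠ 0) {c : ℝ} (hc : 0 ≤ c) (hcx : c • x ≤ M *ᵥ x) (k : ℕ) :
    c ^ k ≤ ‖M ^ k‖ := by
  refine le_of_mul_le_mul_right ?_ (norm_pos_iff.2 hx0)
  calc c ^ k * ‖x‖ = ‖c ^ k • x‖ := by rw [norm_smul, Real.norm_of_nonneg (pow_nonneg hc k)]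
    _ ≤ ‖M ^ k *ᵥ x‖ := (pi_norm_le_iff_of_nonneg (norm_nonneg _)).2 fun i => by
        rw [Real.norm_of_nonneg (smul_nonneg (pow_nonneg hc k) hx i)]
        exact (pow_smul_le_pow_mulVec hM hc hcx k i).trans
          ((Real.le_norm_self _).trans (norm_le_pi_norm _ i))
    _ ≤ ‖M ^ k‖ * ‖x‖ := linfty_opNorm_mulVec _ _

open scoped Matrix.Norms.Operator in
theorem le_realMatrixSpectralRadius_of_smul_le_mulVec (hM : ∀ i j, 0 ≤ M i j) {x : n → ℝ}
    (hx : 0 ≤ x) (hx0 : x ≠ 0) {c : NNReal} (hcx : (c : ℝ) • x ≤ M *ᵥ x) :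
    (c : ENNReal) ≤ realMatrixSpectralRadius M := by
  refine ge_of_tendsto
    (spectrum.pow_nnnorm_pow_one_div_tendsto_nhds_spectralRadius (M.map Complex.ofReal)) ?_
  filter_upwards [eventually_gt_atTop 0] with k hk
  rw [one_div, ENNReal.le_rpow_inv_iff (by positivity), ENNReal.rpow_natCast]
  have hpow : M.map Complex.ofReal ^ k = (M ^ k).map Complex.ofReal :=
    (Matrix.map_pow M Complex.ofRealHom k).symm
  have hnorm : (c : ℝ) ^ k ≤ ‖M.map Complex.ofReal ^ k‖ := by
    rw [hpow, linfty_opNorm_map_ofReal]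
    exact pow_le_linfty_opNorm_pow_of_smul_le_mulVec hM hx hx0 c.coe_nonneg hcx k
  exact_mod_cast hnorm

end SpectralRadius

section Words

open ProbabilityTheory

theorem indepFun_apply_comp {Ω ι κ : Type*} {X : ι → Type*} [MeasurableSpace Ω]
    [∀ i, MeasurableSpace (X i)] {μ : Measure Ω} {f : ∀ i, Ω → X i} (hf : iIndepFun f μ)
    (hmeas : ∀ i, Measurable (f i)) {i : ι} {g : κ → ι} (hi : i ∉ Set.range g) :
    IndepFun (f i) (fun ω k => f (g k) ω) μ := by
  have hindep := indep_iSup_of_disjoint (fun j => (hmeas j).comap_le) hf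
    (Set.disjoint_singleton_left.2 hi)
  rw [iSup_singleton, iSup_range] at hindep
  refine indep_of_indep_of_le_right hindep ?_
  simp only [MeasurableSpace.pi, MeasurableSpace.comap_iSup, MeasurableSpace.comap_comp,
    Function.comp_def, le_refl]

variable {A : Type*}

/-- The infinite word `w` without its first letter. -/
def wordTail (w : ℕ → A) : ℕ → A := fun i => w (i + 1)

/-- The infinite word with first letter `a`, followed by `w`. -/
def wordCons (a : A) (w : ℕ → A) : ℕ → A
  | 0 => a
  | i + 1 => w i

theorem wordTail_iterate_apply (n i : ℕ) (w : ℕ → A) : wordTail^[n] w i = w (i + n) := by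
  induction n generalizing w with
  | zero => rfl
  | succ n ih => rw [Function.iterate_succ_apply, ih, wordTail, add_assoc]

variable [MeasurableSpace A]

theorem measurable_wordTail : Measurable (wordTail : (ℕ → A) → ℕ → A) :=
  measurable_pi_lambda _ fun i => measurable_pi_apply (i + 1)

section InfinitePi

variable (ν : Measure A) [IsProbabilityMeasure ν]

theorem measurePreserving_wordTail_infinitePi :
    MeasurePreserving wordTail (Measure.infinitePi fun _ : ℕ => ν)
      (Measure.infinitePi fun _ : ℕ => ν) :=
  ⟨measurable_wordTail, Measure.map_infinitePi_infinitePi_of_inj Nat.succ_injective⟩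

theorem indepFun_head_wordTail_infinitePi :
    IndepFun (fun w : ℕ → A => w 0) wordTail (Measure.infinitePi fun _ : ℕ => ν) :=
  indepFun_apply_comp (iIndepFun_infinitePi fun _ => measurable_id)
    (fun i => measurable_pi_apply i) (g := Nat.succ) (by simp)

theorem infinitePi_head_tail {s : Set A} (hs : MeasurableSet s) {E : Set (ℕ → A)}
    (hE : MeasurableSet E) :
    Measure.infinitePi (fun _ : ℕ => ν) {w | w 0 ∈ s ∧ wordTail w ∈ E} =
      ν s * Measure.infinitePi (fun _ : ℕ => ν) E := by
  rw [← (measurePreserving_wordTail_infinitePi ν).measure_preimage hE.nullMeasurableSet,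
    ← (measurePreserving_eval_infinitePi (fun _ : ℕ => ν) 0).measure_preimage hs.nullMeasurableSet]
  exact (indepFun_head_wordTail_infinitePi ν).measure_inter_preimage_eq_mul s E hs hE

end InfinitePi

variable [Fintype A] [Nonempty A]

instance : IsProbabilityMeasure (uniformWordMeasure A) := by
  unfold uniformWordMeasure
  infer_instance

theorem measurePreserving_wordTail :
    MeasurePreserving wordTail (uniformWordMeasure A) (uniformWordMeasure A) :=
  measurePreserving_wordTail_infinitePi _

theorem uniformWordMeasure_real_head_tail {s : Set A} (hs : MeasurableSet s) {E : Set (ℕ → A)}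
    (hE : MeasurableSet E) :
    (uniformWordMeasure A).real {w | w 0 ∈ s ∧ wordTail w ∈ E} =
      s.ncard / Fintype.card A * (uniformWordMeasure A).real E := by
  classical
  rw [uniformWordMeasure, Measure.real, infinitePi_head_tail _ hs hE,
    PMF.toMeasure_uniformOfFintype_apply _ hs, ENNReal.toReal_mul, ENNReal.toReal_div,
    ENNReal.toReal_natCast, ENNReal.toReal_natCast, ← Nat.card_eq_fintype_card,
    Nat.card_coe_set_eq, Measure.real]

end Words

section RecurrentChain

variable {α : Type*} {R : α → α → Prop} {S : Set α}

/-- The rank of `x` is the length of a shortest chain that leads from `x` into `S`. -/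
theorem exists_rank_next_of_transGen (h : ∀ x, ∃ y ∈ S, Relation.TransGen R x y) :
    ∃ (rank : α → ℕ) (next : α → α),
      ∀ x, R x (next x) ∧ (next x ∈ S ∨ rank (next x) < rank x) := by
  classical
  let pre (T : Set α) : Set α := {x | ∃ y ∈ T, R x y}
  have hpre (x : α) : ∃ k, x ∈ pre^[k] (pre S) := by
    obtain ⟨y, hy, hxy⟩ := h x
    induction hxy using Relation.TransGen.head_induction_on with
    | single hxy => exact ⟨0, y, hy, hxy⟩
    | head hxz _ ih =>
      obtain ⟨k, hk⟩ := ih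
      exact ⟨k + 1, by rw [Function.iterate_succ_apply']; exact ⟨_, hk, hxz⟩⟩
  have hnext (x : α) :
      ∃ y, R x y ∧ (y ∈ S ∨ Nat.find (hpre y) < Nat.find (hpre x)) := by
    have hx := Nat.find_spec (hpre x)
    rcases hk : Nat.find (hpre x) with _ | k
    · rw [hk] at hx
      obtain ⟨y, hy, hxy⟩ := hx
      exact ⟨y, hxy, .inl hy⟩
    · rw [hk, Function.iterate_succ_apply'] at hx
      obtain ⟨y, hy, hxy⟩ := hx
      exact ⟨y, hxy, .inr (Nat.lt_succ_of_le (Nat.find_min' (hpre y) hy))⟩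
  choose next hR hrank using hnext
  exact ⟨fun x => Nat.find (hpre x), next, fun x => ⟨hR x, hrank x⟩⟩

theorem exists_iterate_mem_of_rank_lt {rank : α → ℕ} {next : α → α}
    (h : ∀ x, next x ∈ S ∨ rank (next x) < rank x) (x : α) : ∃ i, next^[i + 1] x ∈ S := by
  induction hn : rank x using Nat.strong_induction_on generalizing x with
  | _ n ih =>
    rcases h x with hx | hx
    · exact ⟨0, hx⟩
    · obtain ⟨i, hi⟩ := ih _ (hn ▸ hx) (next x) rfl
      exact ⟨i + 1, hi⟩

theorem exists_chain_infinite_mem_of_transGen (h : ∀ x, ∃ y ∈ S, Relation.TransGen R x y)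
    (x : α) : ∃ r : ℕ → α, r 0 = x ∧ (∀ i, R (r i) (r (i + 1))) ∧ {i | r i ∈ S}.Infinite := by
  obtain ⟨rank, next, hnext⟩ := exists_rank_next_of_transGen h
  refine ⟨fun i => next^[i] x, rfl, fun i => ?_, Set.infinite_of_forall_exists_gt fun m => ?_⟩
  · simpa only [Function.iterate_succ_apply'] using (hnext (next^[i] x)).1
  · obtain ⟨i, hi⟩ := exists_iterate_mem_of_rank_lt (fun y => (hnext y).2) (next^[m] x)
    rw [← Function.iterate_add_apply] at hi
    exact ⟨i + 1 + m, hi, by lia⟩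

end RecurrentChain

theorem ae_forall_iterate_notMem {α : Type*} [MeasurableSpace α] {μ : Measure α} {T : α → α}
    (hT : Measure.QuasiMeasurePreserving T μ μ) {E : Set α} (hE : μ E = 0) :
    ∀ᵐ x ∂μ, ∀ k, T^[k] x ∉ E :=
  ae_all_iff.2 fun k => (hT.iterate k).ae (measure_eq_zero_iff_ae_notMem.1 hE)

namespace NBA

variable {A Q : Type*} {U : NBA A Q} {w : ℕ → A} {r : ℕ → Q} {p q : Q}

section Definitions

variable (U)

/-- The successor relation on states. -/
def Adj (p q : Q) : Prop := ∃ a, q ∈ U.step p a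

/-- The automaton with `p` as its only initial state. -/
def startAt (p : Q) : NBA A Q := { U with start := {p} }

/-- The automaton without its transitions into accepting states. -/
def avoidAccept : NBA A Q := { U with step := fun p a => U.step p a \ U.accept }

/-- The prefix of `w` of length `n` labels a path from `p` to `q`. -/
def Reach : ℕ → (ℕ → A) → Q → Q → Prop
  | 0, _, p, q => p = q
  | n + 1, w, p, q => ∃ r ∈ U.step p (w 0), Reach n (wordTail w) r q

/-- No finite word labels two different paths with the same end points. -/
def IsDiamondFree : Prop :=
  ∀ n w p q r r', r ∈ U.step p (w 0) → r' ∈ U.step p (w 0) →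
    U.Reach n (wordTail w) r q → U.Reach n (wordTail w) r' q → r = r'

/-- The infinite words whose prefix of length `n` labels a path from `p`. -/
def liveUpTo (n : ℕ) (p : Q) : Set (ℕ → A) := {w | ∃ q, U.Reach n w p q}

/-- The infinite words all of whose prefixes label paths from `p`. For finitely many states these
are the words with an infinite run from `p`, accepting or not. -/
def live (p : Q) : Set (ℕ → A) := ⋂ n, U.liveUpTo n p

/-- The infinite words that can be read by stepping from `p` to `q` and leave a tail in `E`. -/
def stepInto (p q : Q) (E : Set (ℕ → A)) : Set (ℕ → A) :=
  {w | q ∈ U.step p (w 0) ∧ wordTail w ∈ E}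

/-- The probability that all prefixes of a uniformly random word label paths from a given state. -/
noncomputable def liveProb [Fintype A] [Nonempty A] [MeasurableSpace A] (p : Q) : ℝ :=
  (uniformWordMeasure A).real (U.live p)

end Definitions

section Live

theorem setOf_reach_succ (U : NBA A Q) (n : ℕ) (p q : Q) :
    {w | U.Reach (n + 1) w p q} = ⋃ r, U.stepInto p r {w | U.Reach n w r q} := by
  ext w
  simp [Reach, stepInto]

theorem antitone_liveUpTo (U : NBA A Q) (p : Q) : Antitone fun n => U.liveUpTo n p := by
  refine antitone_nat_of_succ_le fun n => ?_
  induction n generalizing p with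
  | zero => exact fun _ _ => ⟨p, rfl⟩
  | succ n ih =>
    rintro w ⟨q, r, hr, hq⟩
    obtain ⟨q', hq'⟩ := ih r ⟨q, hq⟩
    exact ⟨q', r, hr, hq'⟩

theorem live_subset_iUnion_stepInto [Finite Q] (U : NBA A Q) (p : Q) :
    U.live p ⊆ ⋃ q, U.stepInto p q (U.live q) := by
  intro w hw
  by_contra hcon
  have hdies (r : Q) : ∀ᶠ n in Filter.atTop, r ∈ U.step p (w 0) → wordTail w ∉ U.liveUpTo n r := by
    by_cases hr : r ∈ U.step p (w 0)
    · have hnot : wordTail w ∉ U.live r := fun h => hcon (Set.mem_iUnion.2 ⟨r, hr, h⟩)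
      obtain ⟨m, hm⟩ := not_forall.1 (mt Set.mem_iInter.2 hnot)
      filter_upwards [Filter.eventually_ge_atTop m] with n hn _ h
      exact hm (antitone_liveUpTo U r hn h)
    · exact .of_forall fun n h => absurd h hr
  obtain ⟨n, hn⟩ := (Filter.eventually_all.2 hdies).exists
  obtain ⟨q, r, hr, hq⟩ := Set.mem_iInter.1 hw (n + 1)
  exact hn r hr ⟨q, hq⟩

theorem reach_of_forall_mem_step (h : ∀ i, r (i + 1) ∈ U.step (r i) (w i)) (n : ℕ) :
    U.Reach n w (r 0) (r n) := by
  induction n generalizing w r with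
  | zero => rfl
  | succ n ih => exact ⟨r 1, h 0, ih (r := fun i => r (i + 1)) fun i => h (i + 1)⟩

theorem mem_live_of_forall_mem_step (h : ∀ i, r (i + 1) ∈ U.step (r i) (w i)) :
    w ∈ U.live (r 0) :=
  Set.mem_iInter.2 fun n => ⟨r n, reach_of_forall_mem_step h n⟩

theorem exists_isRun_startAt_of_mem_live [Finite Q] (hw : w ∈ U.live p) :
    ∃ r, (U.startAt p).IsRun w r := by
  choose next hstep hlive using fun x : {x : Q × (ℕ → A) // x.2 ∈ U.live x.1} =>
    Set.mem_iUnion.1 (live_subset_iUnion_stepInto U _ x.2)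
  let g (x : {x : Q × (ℕ → A) // x.2 ∈ U.live x.1}) : {x : Q × (ℕ → A) // x.2 ∈ U.live x.1} :=
    ⟨(next x, wordTail x.1.2), hlive x⟩
  let x (i : ℕ) := g^[i] ⟨(p, w), hw⟩
  have hsucc (i : ℕ) : x (i + 1) = g (x i) := Function.iterate_succ_apply' g i _
  have hword (i : ℕ) : (x i).1.2 = wordTail^[i] w := by
    induction i with
    | zero => rfl
    | succ i ih => rw [hsucc, Function.iterate_succ_apply', ← ih]
  refine ⟨fun i => (x i).1.1, rfl, fun i => ?_⟩
  have hi : (x (i + 1)).1.1 ∈ U.step (x i).1.1 ((x i).1.2 0) := by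
    rw [hsucc]
    exact hstep (x i)
  rwa [hword, wordTail_iterate_apply, zero_add] at hi

theorem exists_wordTail_iterate_mem_live_avoidAccept
    (hr : ∀ i, r (i + 1) ∈ U.step (r i) (w i)) (hfin : {i | r i ∈ U.accept}.Finite) :
    ∃ k q, wordTail^[k] w ∈ U.avoidAccept.live q := by
  obtain ⟨k, hk⟩ := hfin.bddAbove
  refine ⟨k, r k, mem_live_of_forall_mem_step (r := fun i => r (k + i)) fun i =>
    ⟨?_, fun hacc => ?_⟩⟩
  · rw [wordTail_iterate_apply, add_comm i k]
    exact hr (k + i)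
  · have : k + (i + 1) ≤ k := hk hacc
    lia

end Live

section Unambiguous

theorem IsStronglyConnected.transGen_adj (hconn : U.IsStronglyConnected) {s t : Q}
    (hst : U.Adj s t) (p q : Q) : Relation.TransGen U.Adj p q :=
  .trans_right (hconn p s) (.head' hst (hconn t q))

theorem nonempty_omegaLanguage_startAt
    (h : ∀ p, ∃ f ∈ U.accept, Relation.TransGen U.Adj p f) (q : Q) :
    (U.startAt q).omegaLanguage.Nonempty := by
  obtain ⟨r, hr, hadj, hinf⟩ := exists_chain_infinite_mem_of_transGen h q
  choose w hw using hadj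
  exact ⟨w, r, ⟨hr, hw⟩, hinf⟩

theorem IsAcceptingRun.cons {a : A} (h : (U.startAt q).IsAcceptingRun w r)
    (hq : q ∈ U.step p a) :
    (U.startAt p).IsAcceptingRun (wordCons a w) (wordCons p r) := by
  obtain ⟨⟨rfl, hstep⟩, hinf⟩ := h
  refine ⟨⟨rfl, Nat.rec hq fun i _ => hstep i⟩, ?_⟩
  exact (hinf.image Nat.succ_injective.injOn).mono (Set.image_subset_iff.2 fun i hi => hi)

theorem exists_forall_reach_mem_omegaLanguage {v : ℕ → A}
    (hv : v ∈ (U.startAt q).omegaLanguage) (n : ℕ) (w : ℕ → A) :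
    ∃ u, ∀ p, U.Reach n w p q → u ∈ (U.startAt p).omegaLanguage := by
  induction n generalizing w with
  | zero => exact ⟨v, fun p hp => (show p = q from hp) ▸ hv⟩
  | succ n ih =>
    obtain ⟨u, hu⟩ := ih (wordTail w)
    refine ⟨wordCons (w 0) u, fun p ⟨p', hp', hreach⟩ => ?_⟩
    obtain ⟨s, hs⟩ := hu p' hreach
    exact ⟨_, hs.cons hp'⟩

theorem IsUnambiguous.startAt_of_mem_start (h : U.IsUnambiguous) (hp : p ∈ U.start) :
    (U.startAt p).IsUnambiguous := by
  have hrun {w r} (hr : (U.startAt p).IsAcceptingRun w r) : U.IsAcceptingRun w r :=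
    ⟨⟨(show r 0 = p from hr.1.1) ▸ hp, hr.1.2⟩, hr.2⟩
  exact fun w r r' hr hr' => h w r r' (hrun hr) (hrun hr')

theorem IsUnambiguous.startAt_of_adj (h : (U.startAt p).IsUnambiguous) (hpq : U.Adj p q) :
    (U.startAt q).IsUnambiguous := by
  obtain ⟨a, ha⟩ := hpq
  exact fun w r r' hr hr' => congrArg wordTail (h _ _ _ (hr.cons ha) (hr'.cons ha))

theorem IsUnambiguous.startAt (h : U.IsUnambiguous) (hconn : U.IsStronglyConnected)
    (hstart : U.start.Nonempty) (p : Q) : (U.startAt p).IsUnambiguous := by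
  obtain ⟨p₀, hp₀⟩ := hstart
  induction hconn p₀ p with
  | refl => exact h.startAt_of_mem_start hp₀
  | tail _ hadj ih => exact ih.startAt_of_adj hadj

theorem IsUnambiguous.isDiamondFree (h : U.IsUnambiguous) (hconn : U.IsStronglyConnected)
    (hstart : U.start.Nonempty) (haccept : U.accept.Nonempty) : U.IsDiamondFree := by
  intro n w p q r r' hr hr' hreach hreach'
  obtain ⟨f, hf⟩ := haccept
  obtain ⟨v, hv⟩ := nonempty_omegaLanguage_startAt
    (fun s => ⟨f, hf, hconn.transGen_adj ⟨w 0, hr⟩ s f⟩) q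
  obtain ⟨u, hu⟩ := exists_forall_reach_mem_omegaLanguage hv n (wordTail w)
  obtain ⟨s, hs⟩ := hu r hreach
  obtain ⟨s', hs'⟩ := hu r' hreach'
  have heq := h.startAt hconn hstart p _ _ _ (hs.cons hr) (hs'.cons hr')
  calc r = s 0 := hs.1.1.symm
    _ = s' 0 := congrFun heq 1
    _ = r' := hs'.1.1

end Unambiguous

section TransitionMatrix

variable [Fintype A]

theorem transitionMatrix_nonneg (U : NBA A Q) (p q : Q) : 0 ≤ U.transitionMatrix p q :=
  div_nonneg (Nat.cast_nonneg _) (Nat.cast_nonneg _)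

theorem transitionMatrix_pos_iff : 0 < U.transitionMatrix p q ↔ U.Adj p q := by
  refine ⟨fun h => ?_, fun ⟨a, ha⟩ => ?_⟩
  · by_contra hadj
    have hempty : {a | q ∈ U.step p a} = ∅ := Set.eq_empty_of_forall_notMem fun a ha => hadj ⟨a, ha⟩
    simp [transitionMatrix, hempty] at h
  · have : Nonempty A := ⟨a⟩
    have hcard : 0 < {a | q ∈ U.step p a}.ncard := (Set.ncard_pos (Set.toFinite _)).2 ⟨a, ha⟩
    simp only [transitionMatrix, Matrix.of_apply]
    positivity

theorem transitionMatrix_avoidAccept_le (U : NBA A Q) (p q : Q) :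
    U.avoidAccept.transitionMatrix p q ≤ U.transitionMatrix p q :=
  div_le_div_of_nonneg_right
    (Nat.cast_le.2 (Set.ncard_le_ncard (fun _ ha => ha.1) (Set.toFinite _))) (Nat.cast_nonneg _)

theorem transitionMatrix_avoidAccept_eq_zero (hq : q ∈ U.accept) (p : Q) :
    U.avoidAccept.transitionMatrix p q = 0 := by
  simp [transitionMatrix, avoidAccept, hq]

theorem exists_path_toQuiver_transitionMatrix (h : Relation.TransGen U.Adj p q) :
    let := Matrix.toQuiver U.transitionMatrix
    ∃ path : Quiver.Path p q, 0 < path.length := by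
  let := Matrix.toQuiver U.transitionMatrix
  induction h with
  | single hadj =>
    exact ⟨Quiver.Path.nil.cons (PLift.up (transitionMatrix_pos_iff.2 hadj)), one_pos⟩
  | tail _ hadj ih =>
    obtain ⟨path, -⟩ := ih
    exact ⟨path.cons (PLift.up (transitionMatrix_pos_iff.2 hadj)), Nat.succ_pos _⟩

theorem IsStronglyConnected.isIrreducible_transitionMatrix (hconn : U.IsStronglyConnected)
    (hM : U.transitionMatrix ≠ 0) : U.transitionMatrix.IsIrreducible := by
  obtain ⟨s, t, hst⟩ : ∃ s t, U.transitionMatrix s t ≠ 0 := by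
    by_contra! h
    exact hM (Matrix.ext h)
  have hadj := transitionMatrix_pos_iff.1 ((U.transitionMatrix_nonneg s t).lt_of_ne' hst)
  exact ⟨U.transitionMatrix_nonneg, fun p q =>
    exists_path_toQuiver_transitionMatrix (hconn.transGen_adj hadj p q)⟩

end TransitionMatrix

section Measure

variable [MeasurableSpace A]

theorem liveProb_nonneg [Fintype A] [Nonempty A] (U : NBA A Q) : 0 ≤ U.liveProb :=
  fun _ => measureReal_nonneg

theorem liveProb_ne_zero_of_omegaLanguage_pos [Fintype A] [Nonempty A] [Countable Q]
    (h : 0 < uniformWordMeasure A U.omegaLanguage) : U.liveProb ≠ 0 := by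
  intro hzero
  have hsubset : U.omegaLanguage ⊆ ⋃ p, U.live p := fun w ⟨r, hr, _⟩ =>
    Set.mem_iUnion.2 ⟨r 0, mem_live_of_forall_mem_step hr.2⟩
  exact h.ne' <| measure_mono_null hsubset <| measure_iUnion_null fun p =>
    (measureReal_eq_zero_iff).1 (congrFun hzero p)

variable [DiscreteMeasurableSpace A]

theorem measurableSet_stepInto (U : NBA A Q) (p q : Q) {E : Set (ℕ → A)} (hE : MeasurableSet E) :
    MeasurableSet (U.stepInto p q E) := by
  have hhead : Measurable fun w : ℕ → A => w 0 := measurable_pi_apply 0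
  exact (hhead (.of_discrete (s := {a | q ∈ U.step p a}))).inter (measurable_wordTail hE)

theorem measurableSet_setOf_reach [Countable Q] (U : NBA A Q) (n : ℕ) (p q : Q) :
    MeasurableSet {w | U.Reach n w p q} := by
  induction n generalizing p with
  | zero => exact .const (p = q)
  | succ n ih =>
    rw [setOf_reach_succ]
    exact .iUnion fun r => measurableSet_stepInto U p r (ih r)

theorem measurableSet_liveUpTo [Countable Q] (U : NBA A Q) (n : ℕ) (p : Q) :
    MeasurableSet (U.liveUpTo n p) := by
  rw [liveUpTo, Set.ofPred_exists]
  exact .iUnion fun q => measurableSet_setOf_reach U n p q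

theorem measurableSet_live [Countable Q] (U : NBA A Q) (p : Q) : MeasurableSet (U.live p) :=
  .iInter fun n => measurableSet_liveUpTo U n p

variable [Fintype A] [Nonempty A]

theorem uniformWordMeasure_real_stepInto (U : NBA A Q) (p q : Q) {E : Set (ℕ → A)}
    (hE : MeasurableSet E) :
    (uniformWordMeasure A).real (U.stepInto p q E) =
      U.transitionMatrix p q * (uniformWordMeasure A).real E :=
  uniformWordMeasure_real_head_tail (s := {a | q ∈ U.step p a}) .of_discrete hE

theorem liveProb_le_mulVec [Fintype Q] (U : NBA A Q) :
    U.liveProb ≤ U.transitionMatrix.mulVec U.liveProb := fun p =>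
  calc U.liveProb p ≤ (uniformWordMeasure A).real (⋃ q, U.stepInto p q (U.live q)) :=
        measureReal_mono (live_subset_iUnion_stepInto U p)
    _ ≤ ∑ q, (uniformWordMeasure A).real (U.stepInto p q (U.live q)) :=
        measureReal_iUnion_fintype_le _
    _ = ∑ q, U.transitionMatrix p q * U.liveProb q := Finset.sum_congr rfl fun q _ =>
        uniformWordMeasure_real_stepInto U p q (measurableSet_live U q)

open Filter Topology in
theorem tendsto_real_liveUpTo [Countable Q] (U : NBA A Q) (p : Q) :
    Tendsto (fun n => (uniformWordMeasure A).real (U.liveUpTo n p)) atTop (𝓝 (U.liveProb p)) :=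
  (ENNReal.tendsto_toReal (measure_ne_top _ _)).comp <| tendsto_measure_iInter_atTop
    (fun n => (measurableSet_liveUpTo U n p).nullMeasurableSet) (antitone_liveUpTo U p)
    ⟨0, measure_ne_top _ _⟩

variable [Fintype Q]

theorem IsDiamondFree.real_reach [DecidableEq Q] (hU : U.IsDiamondFree) (n : ℕ) (p q : Q) :
    (uniformWordMeasure A).real {w | U.Reach n w p q} = (U.transitionMatrix ^ n) p q := by
  induction n generalizing p with
  | zero => by_cases h : p = q <;> simp [Reach, h]
  | succ n ih =>
    have hdisj : Pairwise (Function.onFun Disjoint fun r =>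
        U.stepInto p r {w | U.Reach n w r q}) := fun r r' hne =>
      Set.disjoint_left.2 fun w hw hw' => hne (hU n w p q r r' hw.1 hw'.1 hw.2 hw'.2)
    rw [setOf_reach_succ, measureReal_iUnion_fintype hdisj fun r =>
      measurableSet_stepInto U p r (measurableSet_setOf_reach U n r q), pow_succ', Matrix.mul_apply]
    refine Finset.sum_congr rfl fun r _ => ?_
    rw [uniformWordMeasure_real_stepInto U p r (measurableSet_setOf_reach U n r q), ih]

end Measure

theorem IsDiamondFree.pow_apply_le_one [Fintype A] [Nonempty A] [Fintype Q] [DecidableEq Q]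
    (hU : U.IsDiamondFree) (n : ℕ) (p q : Q) : (U.transitionMatrix ^ n) p q ≤ 1 := by
  let _ : MeasurableSpace A := ⊤
  exact (hU.real_reach n p q).symm.trans_le measureReal_le_one

section AlmostSure

variable [Fintype A] [Nonempty A] [MeasurableSpace A] [DiscreteMeasurableSpace A]

theorem IsDiamondFree.apply_le_liveProb_mul_sum [Fintype Q] (hU : U.IsDiamondFree) {x : Q → ℝ}
    (hx : 0 ≤ x) (hMx : x ≤ U.transitionMatrix.mulVec x) (p : Q) :
    x p ≤ U.liveProb p * ∑ q, x q := by
  classical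
  refine ge_of_tendsto' ((tendsto_real_liveUpTo U p).mul_const _) fun n => ?_
  have hpow (q : Q) :
      (U.transitionMatrix ^ n) p q ≤ (uniformWordMeasure A).real (U.liveUpTo n p) := by
    rw [← hU.real_reach]
    exact measureReal_mono fun w hw => ⟨q, hw⟩
  exact (le_pow_mulVec U.transitionMatrix_nonneg hMx n p).trans (mulVec_apply_le_mul_sum hx hpow)

theorem IsDiamondFree.liveProb_pos [Fintype Q] (hU : U.IsDiamondFree)
    (hM : U.transitionMatrix.IsIrreducible) {x : Q → ℝ} (hx : 0 ≤ x) (hx0 : x ≠ 0)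
    (hMx : x ≤ U.transitionMatrix.mulVec x) (p : Q) : 0 < U.liveProb p := by
  classical
  have hxp := pos_of_isIrreducible_of_le_mulVec hM hU.pow_apply_le_one hx hx0 hMx p
  exact pos_of_mul_pos_left (hxp.trans_le (hU.apply_le_liveProb_mul_sum hx hMx p))
    (Finset.sum_nonneg fun q _ => hx q)

theorem IsDiamondFree.liveProb_avoidAccept [Finite Q] (hU : U.IsDiamondFree)
    (hM : U.transitionMatrix.IsIrreducible) (haccept : U.accept.Nonempty) :
    U.avoidAccept.liveProb = 0 := by
  classical
  have := Fintype.ofFinite Q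
  by_contra hne
  obtain ⟨f, hf⟩ := haccept
  have heq := eq_of_le_of_isIrreducible_of_le_mulVec hM hU.pow_apply_le_one
    U.transitionMatrix_avoidAccept_le U.avoidAccept.liveProb_nonneg hne
    U.avoidAccept.liveProb_le_mulVec
  obtain ⟨p, hp⟩ := exists_apply_pos_of_isIrreducible hM f
  rw [← heq, transitionMatrix_avoidAccept_eq_zero hf] at hp
  exact hp.false

theorem IsDiamondFree.measure_live_le_omegaLanguage [Finite Q] (hU : U.IsDiamondFree)
    (hM : U.transitionMatrix.IsIrreducible) (haccept : U.accept.Nonempty) (hp : p ∈ U.start) :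
    uniformWordMeasure A (U.live p) ≤ uniformWordMeasure A U.omegaLanguage := by
  have hnull (q : Q) : uniformWordMeasure A (U.avoidAccept.live q) = 0 :=
    (measureReal_eq_zero_iff).1 (congrFun (hU.liveProb_avoidAccept hM haccept) q)
  refine measure_mono_ae ?_
  filter_upwards [ae_all_iff.2 fun q => ae_forall_iterate_notMem
    measurePreserving_wordTail.quasiMeasurePreserving (hnull q)] with w hw hlive
  obtain ⟨r, hr0, hstep⟩ := exists_isRun_startAt_of_mem_live hlive
  refine ⟨r, ⟨(show r 0 = p from hr0) ▸ hp, hstep⟩, fun hfin => ?_⟩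
  obtain ⟨k, q, hkq⟩ := exists_wordTail_iterate_mem_live_avoidAccept (U := U) hstep hfin
  exact hw q k hkq

end AlmostSure

end NBA

theorem mainTheorem3 {A Q : Type*} [Fintype A] [Nontrivial A]
    [MeasurableSpace A] [DiscreteMeasurableSpace A] [Fintype Q] [DecidableEq Q]
    (U : NBA A Q) (hconn : U.IsStronglyConnected) (hunamb : U.IsUnambiguous)
    (hstart : U.start.Nonempty) (haccept : U.accept.Nonempty) :
    realMatrixSpectralRadius U.transitionMatrix ≤ 1 ∧
      (realMatrixSpectralRadius U.transitionMatrix = 1 ↔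
        0 < uniformWordMeasure A U.omegaLanguage) := by
  have hM := U.transitionMatrix_nonneg
  have hU := hunamb.isDiamondFree hconn hstart haccept
  have hle : realMatrixSpectralRadius U.transitionMatrix ≤ 1 :=
    realMatrixSpectralRadius_le_one_of_pow_le hM hU.pow_apply_le_one
  refine ⟨hle, fun hρ => ?_, fun hpos => hle.antisymm ?_⟩
  · obtain ⟨p, hp⟩ := hstart
    have : Nonempty Q := ⟨p⟩
    obtain ⟨x, hx, hx0, hMx⟩ := exists_realMatrixSpectralRadius_smul_le_mulVec hM
    rw [hρ, ENNReal.toReal_one, one_smul] at hMx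
    have hirr := hconn.isIrreducible_transitionMatrix fun hzero =>
      hx0 (le_antisymm (by simpa only [hzero, Matrix.zero_mulVec] using hMx) hx)
    have hlive : 0 < uniformWordMeasure A (U.live p) :=
      (ENNReal.toReal_pos_iff.1 (hU.liveProb_pos hirr hx hx0 hMx p)).1
    exact hlive.trans_le (hU.measure_live_le_omegaLanguage hirr haccept hp)
  · exact_mod_cast le_realMatrixSpectralRadius_of_smul_le_mulVec (c := 1) hM U.liveProb_nonneg
      (NBA.liveProb_ne_zero_of_omegaLanguage_pos hpos)
      (by simpa only [NNReal.coe_one, one_smul] using U.liveProb_le_mulVec)
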